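/- Let $n\ge 1$, $A\in\mathbb{R}^{n\times n}$, $B\in\mathbb{R}^{n\times 1}$ and $T>0$, and suppose that the pair $(A,B)$ is controllable (for all $x_0,x_1\in\mathbb{R}^n$ there are a time $\tau>0$ and an integrable control $u:[0,\tau]\to\mathbb{R}$ for which the solution of $\dot x=Ax+Bu$, $x(0)=x_0$, satisfies $x(\tau)=x_1$) and that $A$ is nonsingular. For an integrable function $u:[0,T]\to\mathbb{R}$ put $\|u\|_\infty=\sup_{t\in[0,T]}|u(t)|$ and let $\|u\|_0$ be the Lebesgue measure of the support of $u$, i.e. of the closure of $\{t\in[0,T]:u(t)\neq 0\}$. Let $$\mathcal{R}=\Bigl\{\int_0^T e^{-As}Bu(s)\,ds \;:\; u\in L^1,\ \|u\|_\infty\le 1\Bigr\}\subset\mathbb{R}^n ,$$ and for $\xi\in\mathbb{R}^n$ let $$\mathcal{U}(\xi)=\Bigl\{u\in L^1 \;:\; \int_0^T e^{-As}Bu(s)\,ds=-\xi,\ \|u\|_\infty\le 1\Bigr\}$$ be the set of controls bounded by $1$ that steer the state of $\dot x=Ax+Bu$ from $x(0)=\xi$ to $x(T)=0$. Then for every $\xi\in\mathcal{R}$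 the minimum $$V(\xi)=\min_{u\in\mathcal{U}(\xi)}\|u\|_0$$ is attained, and $V$ is strictly convex on $\mathcal{R}$: the set $\mathcal{R}$ is convex, and $V((1-\lambda)\xi+\lambda\eta)<(1-\lambda)V(\xi)+\lambda V(\eta)$ for all distinct $\xi,\eta\in\mathcal{R}$ and all $\lambda\in(0,1)$. -/

import Mathlib

namespace HandsOff

open MeasureTheory
open scoped Matrix

/-- The pair `(A, B)` of the single-input system `x' = A x + B u` is controllable: any state `x₀`
can be steered to any state `x₁` in some finite time `τ > 0` by some integrable control `u`
(the state at time `τ` is written through the variation-of-constants formula). -/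
def Controllable {n : ℕ} (A : Matrix (Fin n) (Fin n) ℝ) (B : Fin n → ℝ) : Prop :=
  ∀ x₀ x₁ : Fin n → ℝ, ∃ τ : ℝ, 0 < τ ∧ ∃ u : ℝ → ℝ, IntegrableOn u (Set.Icc 0 τ) ∧
    NormedSpace.exp (τ • A) *ᵥ x₀
      + (∫ s in (0 : ℝ)..τ, u s • (NormedSpace.exp ((τ - s) • A) *ᵥ B)) = x₁

/-- Controls `u ∈ L¹` on `[0, T]` with `‖u‖_∞ = sup_{t ∈ [0, T]} |u t| ≤ 1`.
The values of `u` outside `[0, T]` are irrelevant. -/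
def boundedControls (T : ℝ) : Set (ℝ → ℝ) :=
  {u | IntegrableOn u (Set.Icc 0 T) ∧ ∀ t ∈ Set.Icc 0 T, |u t| ≤ 1}

/-- The vector `∫₀ᵀ e^{-As} B u(s) ds`. -/
noncomputable def steer {n : ℕ} (A : Matrix (Fin n) (Fin n) ℝ) (B : Fin n → ℝ) (T : ℝ)
    (u : ℝ → ℝ) : Fin n → ℝ :=
  ∫ s in (0 : ℝ)..T, u s • (NormedSpace.exp ((-s) • A) *ᵥ B)

/-- The set `𝒰(ξ)` of admissible controls, which steer `ξ` to the origin at time `T`. -/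
def admissible {n : ℕ} (A : Matrix (Fin n) (Fin n) ℝ) (B : Fin n → ℝ) (T : ℝ)
    (ξ : Fin n → ℝ) : Set (ℝ → ℝ) :=
  {u | u ∈ boundedControls T ∧ steer A B T u = -ξ}

/-- The reachable set `ℛ`. -/
def reachable {n : ℕ} (A : Matrix (Fin n) (Fin n) ℝ) (B : Fin n → ℝ) (T : ℝ) :
    Set (Fin n → ℝ) :=
  steer A B T '' boundedControls T

/-- The `L⁰` norm on `[0, T]`: the Lebesgue measure of the support of `u`, which is the closure
of `{t ∈ [0, T] : u t ≠ 0}`. It is finite, the support being a subset of `[0, T]`. -/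
noncomputable def l0norm (T : ℝ) (u : ℝ → ℝ) : ℝ :=
  volume.real (closure {t | t ∈ Set.Icc 0 T ∧ u t ≠ 0})

/-- The value function `V(ξ)` of the maximum hands-off control problem. -/
noncomputable def value {n : ℕ} (A : Matrix (Fin n) (Fin n) ℝ) (B : Fin n → ℝ) (T : ℝ)
    (ξ : Fin n → ℝ) : ℝ :=
  sInf (l0norm T '' admissible A B T ξ)

end HandsOff

open MeasureTheory Filter Topology

namespace HandsOff

/-! ### Convex duality for the L¹ problem. -/

section Abstract

/-! The L⁰ problem is compared with the convex problem of minimising the L¹ norm. A supporting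
functional `(φ, c)` of the set of attainable pairs (endpoint, cost bound) reduces that problem to
minimising `φ (Φ s) * w + c * |w|` over `|w| ≤ 1` at each time, which gives a dead-zone control
(`exists_deadZone_minimizer`). The pointwise minimiser is unique unless `|φ (Φ s)| = c`, a null
event by analyticity, controllability and invertibility of `A` (`Controllable.ae_dual_ne`).

The L¹ norm never exceeds the L⁰ norm, and they agree for the dead-zone control, so `V` is the
optimal L¹ cost, hence convex. If strictness failed, the mixture of the two optimal controls would
be L¹-optimal, hence also valued in {-1, 0, 1} a.e., with equality in the triangle inequality; then
the two controls agree a.e. (`eq_of_combo_bangOffBang`) and steer the same state. -/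

/-- In finite dimensions, a nonempty convex set has a supporting functional at every point outside
its interior, even if that interior is empty. -/
theorem exists_dual_ne_zero_forall_le {E : Type*} [NormedAddCommGroup E] [NormedSpace ℝ E]
    [FiniteDimensional ℝ E] {K : Set E} (hK : Convex ℝ K) (hne : K.Nonempty) {x : E}
    (hx : x ∉ interior K) : ∃ f : E →L[ℝ] ℝ, f ≠ 0 ∧ ∀ y ∈ K, f x ≤ f y := by
  by_cases hint : (interior K).Nonempty
  · obtain ⟨f, hf, h⟩ := geometric_hahn_banach_of_nonempty_interior_point hK hx hint
    exact ⟨-f, neg_ne_zero.mpr hf, fun y hy => by simpa using h y hy⟩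
  -- With empty interior, `K` lies in a proper affine subspace, so some nonzero functional is
  -- constant on it; its sign is then chosen to suit `x`.
  rw [hK.interior_nonempty_iff_affineSpan_eq_top] at hint
  obtain ⟨k, hk⟩ := hne
  have hkspan : k ∈ affineSpan ℝ K := subset_affineSpan ℝ K hk
  have hlt : (affineSpan ℝ K).direction < ⊤ := by
    rw [lt_top_iff_ne_top, Ne, AffineSubspace.direction_eq_top_iff_of_nonempty ⟨k, hkspan⟩]
    exact hint
  obtain ⟨g, hg, hker⟩ := Submodule.exists_le_ker_of_lt_top _ hlt
  have hconst : ∀ y ∈ K, g y = g k := fun y hy => by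
    have := hker (AffineSubspace.vsub_mem_direction (subset_affineSpan ℝ K hy) hkspan)
    simpa [sub_eq_zero] using this
  set f : E →L[ℝ] ℝ := LinearMap.toContinuousLinearMap g with hf
  have hf0 : f ≠ 0 := by simpa [hf] using hg
  rcases le_total (g x) (g k) with h | h
  · exact ⟨f, hf0, fun y hy => by simpa [hf, hconst y hy] using h⟩
  · exact ⟨-f, neg_ne_zero.mpr hf0, fun y hy => by simpa [hf, hconst y hy] using h⟩

/-- The minimiser over `[-1, 1]` of `w ↦ q * w + c * |w|`. -/
noncomputable def deadZone (c q : ℝ) : ℝ :=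
  if c < q then -1 else if q < -c then 1 else 0

theorem abs_deadZone_le (c q : ℝ) : |deadZone c q| ≤ 1 := by
  unfold deadZone; split_ifs <;> simp

theorem deadZone_mem (c q : ℝ) : deadZone c q = -1 ∨ deadZone c q = 0 ∨ deadZone c q = 1 := by
  unfold deadZone; split_ifs <;> simp

theorem measurable_deadZone (c : ℝ) : Measurable (deadZone c) := by
  unfold deadZone
  refine Measurable.ite measurableSet_Ioi measurable_const ?_
  exact Measurable.ite measurableSet_Iio measurable_const measurable_const

/-- The quantitative form of optimality: almost optimal controls must be close to the dead-zone one
wherever `|q| ≠ c`. This replaces weak compactness in the existence proof. -/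
theorem deadZone_gap {c q w : ℝ} (hc : 0 ≤ c) (hw : |w| ≤ 1) :
    q * deadZone c q + c * |deadZone c q| + abs (|q| - c) * |w - deadZone c q|
      ≤ q * w + c * |w| := by
  obtain ⟨h1, h2⟩ := abs_le.mp hw
  unfold deadZone
  split_ifs with h h'
  · have hq : |q| = q := abs_of_pos (hc.trans_lt h)
    rw [hq, abs_of_pos (sub_pos.mpr h), abs_of_nonneg (show 0 ≤ w - -1 by linarith)]
    simp only [abs_neg, abs_one]
    nlinarith [neg_abs_le w]
  · have hq : |q| = -q := abs_of_neg (by linarith)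
    rw [hq, abs_of_pos (show 0 < -q - c by linarith), abs_of_nonpos (show w - 1 ≤ 0 by linarith)]
    simp only [abs_one]
    nlinarith [le_abs_self w]
  · have hq : |q| ≤ c := abs_le.mpr ⟨by linarith, by linarith⟩
    rw [abs_of_nonpos (show |q| - c ≤ 0 by linarith)]
    simp only [sub_zero, mul_zero, abs_zero]
    have := neg_abs_le (q * w)
    rw [abs_mul] at this
    linarith

variable {α : Type*} [MeasurableSpace α] {E : Type*} [NormedAddCommGroup E] [NormedSpace ℝ E]

/-- Measurable controls bounded by `1` almost everywhere. -/
def aeControls (μ : Measure α) : Set (α → ℝ) :=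
  {u | AEStronglyMeasurable u μ ∧ ∀ᵐ s ∂μ, |u s| ≤ 1}

variable {μ : Measure α} {Φ : α → E} {u v : α → ℝ}

theorem integrable_of_mem_aeControls [IsFiniteMeasure μ] (hu : u ∈ aeControls μ) : Integrable u μ :=
  Integrable.of_bound hu.1 1 hu.2

theorem integrable_smul_of_mem_aeControls (hu : u ∈ aeControls μ) (hΦ : Integrable Φ μ) :
    Integrable (fun s => u s • Φ s) μ :=
  hΦ.bdd_smul 1 hu.1 hu.2

theorem combo_mem_aeControls (hu : u ∈ aeControls μ) (hv : v ∈ aeControls μ) {a b : ℝ} (ha : 0 ≤ a)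
    (hb : 0 ≤ b) (hab : a + b = 1) : (fun s => a * u s + b * v s) ∈ aeControls μ := by
  refine ⟨(hu.1.const_mul a).add (hv.1.const_mul b), ?_⟩
  filter_upwards [hu.2, hv.2] with s h1 h2
  calc |a * u s + b * v s| ≤ a * |u s| + b * |v s| := by
        simpa [abs_mul, abs_of_nonneg ha, abs_of_nonneg hb] using abs_add_le (a * u s) (b * v s)
    _ ≤ a * 1 + b * 1 := by gcongr
    _ = 1 := by simpa using hab

theorem integral_combo_smul (hu : u ∈ aeControls μ) (hv : v ∈ aeControls μ)
    (hΦ : Integrable Φ μ) (a b : ℝ) :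
    ∫ s, (a * u s + b * v s) • Φ s ∂μ = a • ∫ s, u s • Φ s ∂μ + b • ∫ s, v s • Φ s ∂μ := by
  simp only [add_smul, mul_smul]
  rw [integral_add (f := fun s => a • u s • Φ s) (g := fun s => b • v s • Φ s)
    ((integrable_smul_of_mem_aeControls hu hΦ).smul a)
    ((integrable_smul_of_mem_aeControls hv hΦ).smul b), integral_smul, integral_smul]

theorem integral_abs_combo_le [IsFiniteMeasure μ] (hu : u ∈ aeControls μ) (hv : v ∈ aeControls μ)
    {a b : ℝ} (ha : 0 ≤ a) (hb : 0 ≤ b) :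
    ∫ s, |a * u s + b * v s| ∂μ ≤ a * ∫ s, |u s| ∂μ + b * ∫ s, |v s| ∂μ := by
  have iu := integrable_of_mem_aeControls hu
  have iv := integrable_of_mem_aeControls hv
  rw [← integral_const_mul, ← integral_const_mul,
    ← integral_add (iu.abs.const_mul a) (iv.abs.const_mul b)]
  refine integral_mono ((iu.const_mul a).add (iv.const_mul b)).abs
    ((iu.abs.const_mul a).add (iv.abs.const_mul b)) fun s => ?_
  simpa [abs_mul, abs_of_nonneg ha, abs_of_nonneg hb] using abs_add_le (a * u s) (b * v s)

theorem deadZone_mem_aeControls {q : α → ℝ} (hq : AEStronglyMeasurable q μ) (c : ℝ) :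
    (fun s => deadZone c (q s)) ∈ aeControls μ :=
  ⟨((measurable_deadZone c).comp_aemeasurable hq.aemeasurable).aestronglyMeasurable,
    ae_of_all _ fun s => abs_deadZone_le c (q s)⟩

/-- Integrated form of `deadZone_gap`. -/
theorem integral_deadZone_gap [IsFiniteMeasure μ] [CompleteSpace E] (hΦ : Integrable Φ μ)
    (φ : E →L[ℝ] ℝ) {c : ℝ} (hc : 0 ≤ c) (hu : u ∈ aeControls μ) :
    Integrable (fun s => abs (|φ (Φ s)| - c) * |u s - deadZone c (φ (Φ s))|) μ ∧
    φ (∫ s, deadZone c (φ (Φ s)) • Φ s ∂μ) + c * ∫ s, |deadZone c (φ (Φ s))| ∂μ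
      + ∫ s, abs (|φ (Φ s)| - c) * |u s - deadZone c (φ (Φ s))| ∂μ
      ≤ φ (∫ s, u s • Φ s ∂μ) + c * ∫ s, |u s| ∂μ := by
  have hq : Integrable (fun s => φ (Φ s)) μ := φ.integrable_comp hΦ
  have hd := deadZone_mem_aeControls hq.1 c
  set d : α → ℝ := fun s => deadZone c (φ (Φ s)) with hd_def
  have hlin : ∀ w ∈ aeControls μ, Integrable (fun s => φ (Φ s) * w s + c * |w s|) μ ∧
      φ (∫ s, w s • Φ s ∂μ) + c * ∫ s, |w s| ∂μ = ∫ s, φ (Φ s) * w s + c * |w s| ∂μ := by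
    intro w hw
    have i1 : Integrable (fun s => φ (Φ s) * w s) μ := by
      simpa [mul_comm] using φ.integrable_comp (integrable_smul_of_mem_aeControls hw hΦ)
    have i2 := (integrable_of_mem_aeControls hw).abs.const_mul c
    refine ⟨i1.add i2, ?_⟩
    rw [integral_add i1 i2, integral_const_mul, ← φ.integral_comp_comm (integrable_smul_of_mem_aeControls hw hΦ)]
    simp [mul_comm]
  have hgi : Integrable (fun s => abs (|φ (Φ s)| - c) * |u s - d s|) μ := by
    have hh : Integrable (fun s => abs (|φ (Φ s)| - c)) μ :=
      (hq.abs.sub (integrable_const c)).abs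
    refine hh.mul_bdd (c := 2) (hu.1.sub hd.1).norm ?_
    filter_upwards [hu.2, hd.2] with s h1 h2
    simp only [Real.norm_eq_abs, abs_abs]
    exact (abs_sub _ _).trans (by simp only [hd_def] at h2 ⊢; linarith)
  refine ⟨hgi, ?_⟩
  rw [(hlin u hu).2, (hlin d hd).2, ← integral_add (hlin d hd).1 hgi]
  refine integral_mono_ae ((hlin d hd).1.add hgi) (hlin u hu).1 ?_
  filter_upwards [hu.2] with s hs
  exact deadZone_gap hc hs

/-- **Maximum principle for the `L¹`-optimal control problem**: if no nontrivial affine functional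
vanishes along `Φ` on a set of positive measure, then each reachable `x` is reached by a dead-zone
control, and this is, up to null sets, the only control of minimal `L¹` norm reaching `x`. -/
theorem exists_deadZone_minimizer [IsFiniteMeasure μ] [FiniteDimensional ℝ E]
    (hΦ : Integrable Φ μ)
    (hnd : ∀ (φ : E →L[ℝ] ℝ) (c : ℝ), φ ≠ 0 ∨ c ≠ 0 → ∀ᵐ s ∂μ, φ (Φ s) ≠ c)
    {x : E} (hx : ∃ u ∈ aeControls μ, ∫ s, u s • Φ s ∂μ = x) :
    ∃ (φ : E →L[ℝ] ℝ) (c : ℝ), 0 ≤ c ∧ (φ ≠ 0 ∨ c ≠ 0) ∧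
      ∫ s, deadZone c (φ (Φ s)) • Φ s ∂μ = x ∧
      ∀ u ∈ aeControls μ, ∫ s, u s • Φ s ∂μ = x →
        ∫ s, |deadZone c (φ (Φ s))| ∂μ ≤ ∫ s, |u s| ∂μ ∧
        (∫ s, |u s| ∂μ = ∫ s, |deadZone c (φ (Φ s))| ∂μ →
          u =ᵐ[μ] fun s => deadZone c (φ (Φ s))) := by
  have : CompleteSpace E := FiniteDimensional.complete ℝ E
  set S : Set ℝ := (fun u : α → ℝ => ∫ s, |u s| ∂μ) ''
    {u | u ∈ aeControls μ ∧ ∫ s, u s • Φ s ∂μ = x} with hS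
  have hSne : S.Nonempty := by
    obtain ⟨u, hu, hux⟩ := hx
    exact ⟨_, u, ⟨hu, hux⟩, rfl⟩
  have hSbdd : BddBelow S := ⟨0, by
    rintro _ ⟨u, -, rfl⟩
    exact integral_nonneg fun s => abs_nonneg _⟩
  set m := sInf S with hm
  -- The inequality in the cost makes `K` convex and upward closed; the latter forces `0 ≤ c` below.
  set K : Set (E × ℝ) := {p | ∃ u ∈ aeControls μ, ∫ s, u s • Φ s ∂μ = p.1 ∧ ∫ s, |u s| ∂μ ≤ p.2}
    with hK
  have hKconv : Convex ℝ K := by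
    rintro p ⟨u, hu, hu1, hu2⟩ p' ⟨v, hv, hv1, hv2⟩ a b ha hb hab
    refine ⟨_, combo_mem_aeControls hu hv ha hb hab, ?_, ?_⟩
    · simp [integral_combo_smul hu hv hΦ, hu1, hv1]
    · refine (integral_abs_combo_le hu hv ha hb).trans ?_
      simp only [Prod.snd_add, Prod.smul_snd, smul_eq_mul]
      gcongr
  have hmK : (x, m) ∉ interior K := by
    intro h
    have hcont : Tendsto (fun ε : ℝ => (x, m - ε)) (𝓝[>] 0) (𝓝 (x, m)) := by
      have : Continuous fun ε : ℝ => (x, m - ε) := by fun_prop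
      simpa using (this.tendsto 0).mono_left nhdsWithin_le_nhds
    obtain ⟨ε, hεK, hε⟩ := ((hcont.eventually (mem_interior_iff_mem_nhds.mp h)).and
      self_mem_nhdsWithin).exists
    obtain ⟨u, hu, hux, hule⟩ := hεK
    have h1 : m ≤ ∫ s, |u s| ∂μ := csInf_le hSbdd ⟨u, ⟨hu, hux⟩, rfl⟩
    have h2 : (0 : ℝ) < ε := hε
    linarith [show ∫ s, |u s| ∂μ ≤ m - ε from hule]
  obtain ⟨u₀, hu₀, hu₀x⟩ := hx
  obtain ⟨f, hf0, hf⟩ := exists_dual_ne_zero_forall_le hKconv ⟨(x, _), u₀, hu₀, hu₀x, le_rfl⟩ hmK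
  set φ : E →L[ℝ] ℝ := f.comp (ContinuousLinearMap.inl ℝ E ℝ) with hφ
  set c : ℝ := f (0, 1) with hc
  have hfφ : ∀ y r, f (y, r) = φ y + c * r := fun y r => by
    have : (y, r) = ((y, 0) : E × ℝ) + r • ((0, 1) : E × ℝ) := by simp
    rw [this, map_add, map_smul, smul_eq_mul, mul_comm]
    rfl
  have hφc : φ ≠ 0 ∨ c ≠ 0 := by
    by_contra! h
    apply hf0
    ext p
    · simpa [hfφ] using congrArg (fun g : E →L[ℝ] ℝ => g p) h.1
    · simpa [hc] using h.2
  have hc0 : 0 ≤ c := by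
    by_contra! hneg
    set J := ∫ s, |u₀ s| ∂μ
    have hJ : m ≤ J := csInf_le hSbdd ⟨u₀, ⟨hu₀, hu₀x⟩, rfl⟩
    have := hf (x, J + 1) ⟨u₀, hu₀, hu₀x, by simp [J]⟩
    rw [hfφ, hfφ] at this
    nlinarith
  set d : α → ℝ := fun s => deadZone c (φ (Φ s)) with hd_def
  have hq : Integrable (fun s => φ (Φ s)) μ := φ.integrable_comp hΦ
  have hd : d ∈ aeControls μ := deadZone_mem_aeControls hq.1 c
  have hh : ∀ᵐ s ∂μ, abs (|φ (Φ s)| - c) ≠ 0 := by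
    filter_upwards [hnd φ c hφc, hnd φ (-c) (by simpa using hφc)] with s h1 h2 h3
    rw [abs_eq_zero, sub_eq_zero, abs_eq hc0] at h3
    tauto
  have hdle : φ x + c * m ≤ φ (∫ s, d s • Φ s ∂μ) + c * ∫ s, |d s| ∂μ := by
    simpa only [hfφ] using hf (_, _) ⟨d, hd, rfl, le_rfl⟩
  have hgap : ∀ u ∈ aeControls μ, ∫ s, u s • Φ s ∂μ = x →
      ∫ s, abs (|φ (Φ s)| - c) * |u s - d s| ∂μ ≤ c * (∫ s, |u s| ∂μ - m) := by
    intro u hu hux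
    have := (integral_deadZone_gap hΦ φ hc0 hu).2
    rw [hux] at this
    linarith
  -- Along a minimising sequence the integrated gap tends to 0. As its weight is a.e. nonzero, a
  -- subsequence converges a.e. to `d`, and dominated convergence passes the endpoint to the limit.
  have hdx : ∫ s, d s • Φ s ∂μ = x := by
    have hseq : ∀ k : ℕ, ∃ u, u ∈ aeControls μ ∧ ∫ s, u s • Φ s ∂μ = x ∧
        ∫ s, |u s| ∂μ < m + 1 / ((k : ℝ) + 1) := fun k => by
      obtain ⟨_, ⟨u, ⟨hu, hux⟩, rfl⟩, hlt⟩ :=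
        exists_lt_of_csInf_lt hSne (lt_add_of_pos_right m (Nat.one_div_pos_of_nat (n := k)))
      exact ⟨u, hu, hux, hlt⟩
    choose U hU hUx hUlt using hseq
    set g : ℕ → α → ℝ := fun k s => abs (|φ (Φ s)| - c) * |U k s - d s| with hg
    have hgi : ∀ k, Integrable (g k) μ := fun k => (integral_deadZone_gap hΦ φ hc0 (hU k)).1
    have hg0 : ∀ k s, 0 ≤ g k s := fun k s => mul_nonneg (abs_nonneg _) (abs_nonneg _)
    have hlim : Tendsto (fun k => ∫ s, g k s ∂μ) atTop (𝓝 0) := by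
      refine squeeze_zero (fun k => integral_nonneg (hg0 k)) (fun k => ?_)
        (g := fun k : ℕ => c * (1 / ((k : ℝ) + 1))) ?_
      · refine (hgap _ (hU k) (hUx k)).trans ?_
        have := hUlt k
        gcongr
        linarith
      · simpa using (tendsto_one_div_add_atTop_nhds_zero_nat (𝕜 := ℝ)).const_mul c
    have hmeas : TendstoInMeasure μ g atTop (fun _ => (0 : ℝ)) := by
      refine tendstoInMeasure_of_tendsto_eLpNorm one_ne_zero (fun k => (hgi k).1)
        aestronglyMeasurable_const ?_
      have : ∀ k, eLpNorm (g k - fun _ => (0 : ℝ)) 1 μ = ENNReal.ofReal (∫ s, g k s ∂μ) := by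
        intro k
        rw [ofReal_integral_eq_lintegral_ofReal (hgi k) (ae_of_all _ (hg0 k)),
          eLpNorm_one_eq_lintegral_enorm]
        refine lintegral_congr fun s => ?_
        simp [Real.enorm_of_nonneg (hg0 k s)]
      simp_rw [this]
      simpa using ENNReal.tendsto_ofReal hlim
    obtain ⟨ns, -, hns⟩ := hmeas.exists_seq_tendsto_ae
    have hlimU : ∀ᵐ s ∂μ, Tendsto (fun i => U (ns i) s) atTop (𝓝 (d s)) := by
      filter_upwards [hns, hh] with s h1 h2
      rw [tendsto_iff_norm_sub_tendsto_zero]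
      have := h1.const_mul (abs (|φ (Φ s)| - c))⁻¹
      simpa [hg, h2, inv_mul_cancel_left₀] using this
    refine tendsto_nhds_unique (tendsto_integral_of_dominated_convergence
      (F := fun i s => U (ns i) s • Φ s) (fun s => ‖Φ s‖)
      (fun i => (integrable_smul_of_mem_aeControls (hU _) hΦ).1) hΦ.norm (fun i => ?_) ?_) ?_
    · filter_upwards [(hU (ns i)).2] with s hs
      rw [norm_smul]
      exact mul_le_of_le_one_left (norm_nonneg _) hs
    · filter_upwards [hlimU] with s hs using hs.smul_const _
    · simp [hUx]
  refine ⟨φ, c, hc0, hφc, hdx, fun u hu hux => ?_⟩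
  obtain ⟨hgi, hle⟩ := integral_deadZone_gap hΦ φ hc0 hu
  simp only [← hd_def] at hgi hle ⊢
  have hgnn : ∀ s, 0 ≤ abs (|φ (Φ s)| - c) * |u s - d s| := fun s =>
    mul_nonneg (abs_nonneg _) (abs_nonneg _)
  have huniq : ∫ s, abs (|φ (Φ s)| - c) * |u s - d s| ∂μ ≤ 0 → u =ᵐ[μ] d := fun h => by
    have h0 := le_antisymm h (integral_nonneg hgnn)
    rw [integral_eq_zero_iff_of_nonneg hgnn hgi] at h0
    filter_upwards [h0, hh] with s h1 h2
    have := (mul_eq_zero.mp h1).resolve_left h2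
    exact sub_eq_zero.mp (abs_eq_zero.mp this)
  have hgint : 0 ≤ ∫ s, abs (|φ (Φ s)| - c) * |u s - d s| ∂μ := integral_nonneg hgnn
  rw [hux, hdx] at hle
  constructor
  -- If `c = 0` the cost drops out, and the gap forces every control reaching `x` to equal `d` a.e.
  · rcases hc0.eq_or_lt with h | h
    · have heq := huniq (by
        linarith [mul_eq_zero_of_left h.symm (∫ s, |d s| ∂μ),
          mul_eq_zero_of_left h.symm (∫ s, |u s| ∂μ)])
      refine (integral_congr_ae ?_).le
      filter_upwards [heq] with s hs
      rw [hs]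
    · exact le_of_mul_le_mul_left (by linarith) h
  · intro heq
    apply huniq
    rw [heq] at hle
    linarith

end Abstract

end HandsOff
open scoped Matrix

namespace HandsOff

/-! ### Normality of the linear system. -/

section LinearSystem

variable {n : ℕ} {A : Matrix (Fin n) (Fin n) ℝ} {B : Fin n → ℝ}

open scoped Matrix.Norms.Operator in
theorem analyticAt_dual_exp_mulVec (A : Matrix (Fin n) (Fin n) ℝ) (B : Fin n → ℝ)
    (φ : (Fin n → ℝ) →L[ℝ] ℝ) (s : ℝ) :
    AnalyticAt ℝ (fun s : ℝ => φ (NormedSpace.exp ((-s) • A) *ᵥ B)) s := by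
  let L : Matrix (Fin n) (Fin n) ℝ →L[ℝ] ℝ := LinearMap.toContinuousLinearMap
    (φ.toLinearMap ∘ₗ (Matrix.mulVecBilin ℝ ℝ).flip B)
  have h1 : AnalyticAt ℝ (fun s : ℝ => (-s) • A) s := by fun_prop
  have h2 : AnalyticAt ℝ (fun s : ℝ => NormedSpace.exp ((-s) • A)) s :=
    AnalyticAt.comp (f := fun s : ℝ => (-s) • A) (NormedSpace.exp_analytic (𝕂 := ℝ) ((-s) • A)) h1
  exact (L.analyticAt _).comp h2

open scoped Matrix.Norms.Operator in
theorem hasDerivAt_dual_exp_mulVec (A : Matrix (Fin n) (Fin n) ℝ) (B : Fin n → ℝ)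
    (φ : (Fin n → ℝ) →L[ℝ] ℝ) (s : ℝ) :
    HasDerivAt (fun s : ℝ => φ (NormedSpace.exp ((-s) • A) *ᵥ B))
      (-φ (A *ᵥ (NormedSpace.exp ((-s) • A) *ᵥ B))) s := by
  let L : Matrix (Fin n) (Fin n) ℝ →L[ℝ] ℝ := LinearMap.toContinuousLinearMap
    (φ.toLinearMap ∘ₗ (Matrix.mulVecBilin ℝ ℝ).flip B)
  have h := L.hasFDerivAt.comp_hasDerivAt s (hasDerivAt_exp_smul_const' (𝕂 := ℝ) (-A) s)
  convert! h using 1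
  · ext t
    simp [L]
    rfl
  · rw [Matrix.mulVec_mulVec, ← map_neg, ← Matrix.neg_mulVec, ← Matrix.neg_mul, smul_neg, neg_smul]
    rfl

theorem continuous_exp_mulVec (A : Matrix (Fin n) (Fin n) ℝ) (B : Fin n → ℝ) :
    Continuous fun s : ℝ => NormedSpace.exp ((-s) • A) *ᵥ B :=
  continuous_pi fun i => continuous_iff_continuousAt.mpr fun s =>
    (analyticAt_dual_exp_mulVec A B (ContinuousLinearMap.proj i) s).continuousAt

/-- Such a `φ` kills every state reachable from 0, and those fill the space. -/
theorem Controllable.dual_eq_zero (hAB : Controllable A B) {φ : (Fin n → ℝ) →L[ℝ] ℝ}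
    (hφ : ∀ s : ℝ, φ (NormedSpace.exp ((-s) • A) *ᵥ B) = 0) : φ = 0 := by
  ext1 x
  obtain ⟨τ, -, u, -, hx⟩ := hAB 0 x
  rw [Matrix.mulVec_zero, zero_add] at hx
  rw [← hx]
  by_cases hi : IntervalIntegrable (fun s => u s • (NormedSpace.exp ((τ - s) • A) *ᵥ B))
    volume 0 τ
  · rw [← φ.intervalIntegral_comp_comm hi]
    have h0 : ∀ s, φ (NormedSpace.exp ((τ - s) • A) *ᵥ B) = 0 := fun s => by
      simpa using hφ (s - τ)
    simp [h0]
  -- The integral of a non-integrable function is 0 by convention.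
  · rw [intervalIntegral.integral_undef hi]
    simp

/-- Normality: on no set of positive measure is `φ (e^{-As} B)` equal to a constant `c`, unless
both `φ` and `c` vanish. -/
theorem Controllable.ae_dual_ne (hAB : Controllable A B) (hA : A.det ≠ 0)
    (φ : (Fin n → ℝ) →L[ℝ] ℝ) (c : ℝ) (h : φ ≠ 0 ∨ c ≠ 0) :
    ∀ᵐ s : ℝ, φ (NormedSpace.exp ((-s) • A) *ᵥ B) ≠ c := by
  set q : ℝ → ℝ := fun s => φ (NormedSpace.exp ((-s) • A) *ᵥ B) with hq
  -- A nonconstant analytic function takes each value on a null set. If `q` is constantly `c`,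
  -- differentiating shows that `φ ∘ A` vanishes along the orbit of `B`, so `φ = 0` and then `c =
  -- 0`.
  by_cases hconst : ∃ s, q s ≠ c
  · obtain ⟨s₀, hs₀⟩ := hconst
    have han : AnalyticOnNhd ℝ (fun s => q s - c) Set.univ := fun s _ =>
      (analyticAt_dual_exp_mulVec A B φ s).sub analyticAt_const
    have hcod := han.preimage_zero_mem_codiscrete (x := s₀) (sub_ne_zero.mpr hs₀)
    have hae := ae_restrict_le_codiscreteWithin (μ := volume) MeasurableSet.univ hcod
    rw [Measure.restrict_univ] at hae
    filter_upwards [hae] with s hs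
    exact sub_ne_zero.mp hs
  · push Not at hconst
    exfalso
    let ψ : (Fin n → ℝ) →L[ℝ] ℝ := φ.comp (LinearMap.toContinuousLinearMap A.mulVecLin)
    have hψ : ψ = 0 := hAB.dual_eq_zero fun s => by
      have h1 := hasDerivAt_dual_exp_mulVec A B φ s
      have h2 : HasDerivAt q 0 s := by
        rw [funext hconst]
        exact hasDerivAt_const s c
      exact neg_eq_zero.mp (h1.unique h2)
    have hφ : φ = 0 := by
      ext1 x
      have hx : A *ᵥ (A⁻¹ *ᵥ x) = x := by
        rw [Matrix.mulVec_mulVec, Matrix.mul_nonsing_inv _ (isUnit_iff_ne_zero.mpr hA),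
          Matrix.one_mulVec]
      have := congrArg (fun g : (Fin n → ℝ) →L[ℝ] ℝ => g (A⁻¹ *ᵥ x)) hψ
      simpa [ψ, hx] using this
    refine h.elim (fun h => h hφ) fun h => h ?_
    rw [← hconst 0]
    simp [hq, hφ]

end LinearSystem

/-! ### Comparison of the L⁰ and L¹ norms. -/

section Controls

variable {n : ℕ} {A : Matrix (Fin n) (Fin n) ℝ} {B : Fin n → ℝ} {T : ℝ}

theorem mem_aeControls_of_mem_boundedControls {u : ℝ → ℝ} (hu : u ∈ boundedControls T) :
    u ∈ aeControls (volume.restrict (Set.Icc 0 T)) :=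
  ⟨hu.1.aestronglyMeasurable, (ae_restrict_iff' measurableSet_Icc).mpr (ae_of_all _ hu.2)⟩

theorem steer_eq_setIntegral (hT : 0 ≤ T) (u : ℝ → ℝ) :
    steer A B T u = ∫ s in Set.Icc 0 T, u s • (NormedSpace.exp ((-s) • A) *ᵥ B) := by
  rw [steer, intervalIntegral.integral_of_le hT, integral_Icc_eq_integral_Ioc]

theorem integrableOn_exp_mulVec (A : Matrix (Fin n) (Fin n) ℝ) (B : Fin n → ℝ) (T : ℝ) :
    IntegrableOn (fun s : ℝ => NormedSpace.exp ((-s) • A) *ᵥ B) (Set.Icc 0 T) :=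
  (continuous_exp_mulVec A B).continuousOn.integrableOn_Icc

theorem combo_mem_boundedControls {u v : ℝ → ℝ} (hu : u ∈ boundedControls T)
    (hv : v ∈ boundedControls T) {a b : ℝ} (ha : 0 ≤ a) (hb : 0 ≤ b) (hab : a + b = 1) :
    (fun s => a * u s + b * v s) ∈ boundedControls T := by
  refine ⟨(hu.1.const_mul a).add (hv.1.const_mul b), fun t ht => ?_⟩
  have h1 := abs_le.mp (hu.2 t ht)
  have h2 := abs_le.mp (hv.2 t ht)
  exact abs_le.mpr ⟨by nlinarith, by nlinarith⟩

theorem steer_combo (hT : 0 ≤ T) {u v : ℝ → ℝ} (hu : u ∈ boundedControls T)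
    (hv : v ∈ boundedControls T) (a b : ℝ) :
    steer A B T (fun s => a * u s + b * v s) = a • steer A B T u + b • steer A B T v := by
  simp only [steer_eq_setIntegral hT]
  exact integral_combo_smul (mem_aeControls_of_mem_boundedControls hu) (mem_aeControls_of_mem_boundedControls hv) (integrableOn_exp_mulVec A B T) a b

theorem convex_reachable (hT : 0 ≤ T) : Convex ℝ (reachable A B T) := by
  rintro _ ⟨u, hu, rfl⟩ _ ⟨v, hv, rfl⟩ a b ha hb hab
  exact ⟨_, combo_mem_boundedControls hu hv ha hb hab, steer_combo hT hu hv a b⟩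

theorem support_closure_subset (T : ℝ) (u : ℝ → ℝ) :
    closure {t | t ∈ Set.Icc 0 T ∧ u t ≠ 0} ⊆ Set.Icc 0 T :=
  closure_minimal (fun _ ht => ht.1) isClosed_Icc

/-- On `[0, T]`, `|u|` is bounded by the indicator of its closed support. -/
theorem integral_abs_le_l0norm {u : ℝ → ℝ} (hu : u ∈ boundedControls T) :
    ∫ s in Set.Icc 0 T, |u s| ≤ l0norm T u := by
  set C := closure {t | t ∈ Set.Icc 0 T ∧ u t ≠ 0} with hC
  have hCm : MeasurableSet C := isClosed_closure.measurableSet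
  have hle : ∫ s in Set.Icc 0 T, |u s| ≤ ∫ s in Set.Icc 0 T, C.indicator (fun _ => (1 : ℝ)) s := by
    refine setIntegral_mono_on hu.1.abs ((integrable_const 1).indicator hCm) measurableSet_Icc
      fun s hs => ?_
    by_cases h : u s = 0
    · simpa [h] using Set.indicator_nonneg (fun _ _ => zero_le_one) s
    · rw [Set.indicator_of_mem (show s ∈ C from subset_closure ⟨hs, h⟩)]
      exact hu.2 s hs
  refine hle.trans (le_of_eq ?_)
  rw [integral_indicator_const _ hCm, smul_eq_mul, mul_one, l0norm, measureReal_restrict_apply hCm,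
    Set.inter_eq_left.mpr (support_closure_subset T u)]

/-- A dead-zone control has `L⁰` norm equal to its `L¹` norm, as the closure of its support adds
only points at which the switching function has modulus `c`. -/
theorem l0norm_deadZone {q : ℝ → ℝ} (hq : Continuous q) {c : ℝ} (hc : 0 ≤ c)
    (hne : ∀ᵐ s : ℝ, q s ≠ c) (hne' : ∀ᵐ s : ℝ, q s ≠ -c) :
    l0norm T (fun s => deadZone c (q s)) = ∫ s in Set.Icc 0 T, |deadZone c (q s)| := by
  set C := closure {t | t ∈ Set.Icc 0 T ∧ deadZone c (q t) ≠ 0} with hC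
  have hCm : MeasurableSet C := isClosed_closure.measurableSet
  have hCq : C ⊆ {t | c ≤ |q t|} := by
    refine closure_minimal (fun t ht => ?_) (isClosed_le continuous_const hq.abs)
    have h := ht.2
    unfold deadZone at h
    split_ifs at h with h1 h2
    · exact h1.le.trans (le_abs_self _)
    · exact (show c ≤ -q t by linarith).trans (neg_le_abs _)
    · exact absurd rfl h
  have heq : ∫ s in Set.Icc 0 T, |deadZone c (q s)|
      = ∫ s in Set.Icc 0 T, C.indicator (fun _ => (1 : ℝ)) s := by
    refine setIntegral_congr_ae measurableSet_Icc ?_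
    filter_upwards [hne, hne'] with s h1 h2 hs
    by_cases h : s ∈ C
    · rw [Set.indicator_of_mem h]
      rcases le_abs.mp (show c ≤ |q s| from hCq h) with h3 | h3
      · simp [deadZone, lt_of_le_of_ne h3 h1.symm]
      · have h4 : q s < -c := lt_of_le_of_ne (by linarith) h2
        simp [deadZone, h4, show ¬ c < q s by linarith]
    · rw [Set.indicator_of_notMem h]
      by_contra h0
      exact h (subset_closure ⟨hs, fun h5 => h0 (by simp [h5])⟩)
  rw [heq, integral_indicator_const _ hCm, smul_eq_mul, mul_one, l0norm,
    measureReal_restrict_apply hCm, Set.inter_eq_left.mpr (support_closure_subset T _)]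

/-- The `L¹`-optimal control exists, is unique up to null sets, is bang-off-bang, and its `L¹` and
`L⁰` norms agree. -/
theorem exists_bangOffBang_minimizer (hT : 0 ≤ T) (hAB : Controllable A B) (hA : A.det ≠ 0)
    {ξ : Fin n → ℝ} (hξ : ξ ∈ reachable A B T) :
    ∃ u ∈ admissible A B T ξ, (∀ s, u s = -1 ∨ u s = 0 ∨ u s = 1) ∧
      l0norm T u = ∫ s in Set.Icc 0 T, |u s| ∧
      ∀ v ∈ admissible A B T ξ, ∫ s in Set.Icc 0 T, |u s| ≤ ∫ s in Set.Icc 0 T, |v s| ∧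
        (∫ s in Set.Icc 0 T, |v s| = ∫ s in Set.Icc 0 T, |u s| →
          v =ᵐ[volume.restrict (Set.Icc 0 T)] u) := by
  obtain ⟨w, hw, hwξ⟩ := hξ
  -- `reachable` is defined with `ξ` and `admissible` with `-ξ`; the control bound is symmetric.
  have hw' : (fun s => -w s) ∈ boundedControls T := ⟨hw.1.neg, fun t ht => by
    simpa using hw.2 t ht⟩
  have hwx : ∫ s in Set.Icc 0 T, (-w s) • (NormedSpace.exp ((-s) • A) *ᵥ B) = -ξ := by
    rw [← hwξ, steer_eq_setIntegral hT, ← integral_neg]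
    simp
  obtain ⟨φ, c, hc, hφc, hx, hmin⟩ := exists_deadZone_minimizer
    (μ := volume.restrict (Set.Icc 0 T)) (integrableOn_exp_mulVec A B T)
    (fun φ c h => ae_restrict_of_ae (hAB.ae_dual_ne hA φ c h)) ⟨_, (mem_aeControls_of_mem_boundedControls hw'), hwx⟩
  have hqc : Continuous fun s : ℝ => φ (NormedSpace.exp ((-s) • A) *ᵥ B) :=
    φ.continuous.comp (continuous_exp_mulVec A B)
  refine ⟨fun s => deadZone c (φ (NormedSpace.exp ((-s) • A) *ᵥ B)), ⟨⟨?_, fun t _ =>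
    abs_deadZone_le _ _⟩, ?_⟩, fun s => deadZone_mem _ _, l0norm_deadZone hqc hc
    (hAB.ae_dual_ne hA φ c hφc) (hAB.ae_dual_ne hA φ (-c) (by simpa using hφc)), fun v hv => ?_⟩
  · exact integrable_of_mem_aeControls
      (deadZone_mem_aeControls hqc.aestronglyMeasurable c)
  · rw [steer_eq_setIntegral hT, hx]
  · exact hmin v (mem_aeControls_of_mem_boundedControls hv.1) (by rw [← steer_eq_setIntegral hT, hv.2])

theorem isLeast_l0norm {ξ : Fin n → ℝ} {u : ℝ → ℝ} (hu : u ∈ admissible A B T ξ)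
    (hl0 : l0norm T u = ∫ s in Set.Icc 0 T, |u s|)
    (hmin : ∀ v ∈ admissible A B T ξ, ∫ s in Set.Icc 0 T, |u s| ≤ ∫ s in Set.Icc 0 T, |v s|) :
    IsLeast (l0norm T '' admissible A B T ξ) (∫ s in Set.Icc 0 T, |u s|) := by
  refine ⟨⟨u, hu, hl0⟩, ?_⟩
  rintro _ ⟨v, hv, rfl⟩
  exact (hmin v hv).trans (integral_abs_le_l0norm hv.1)

/-- For distinct `x`, `y` the mixture lies strictly between -1 and 1, so it must be 0; this needs
opposite signs and `a = b`, which `habs` excludes. -/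
theorem eq_of_combo_bangOffBang {a b x y : ℝ} (ha : 0 < a) (hb : 0 < b) (hab : a + b = 1)
    (hx : x = -1 ∨ x = 0 ∨ x = 1) (hy : y = -1 ∨ y = 0 ∨ y = 1)
    (hz : a * x + b * y = -1 ∨ a * x + b * y = 0 ∨ a * x + b * y = 1)
    (habs : |a * x + b * y| = a * |x| + b * |y|) : x = y := by
  obtain rfl : b = 1 - a := by linarith
  rcases hx with rfl | rfl | rfl <;> rcases hy with rfl | rfl | rfl <;>
    first
      | rfl
      | (exfalso; rcases hz with hz | hz | hz <;> rw [hz] at habs <;> norm_num at habs <;> linarith)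

end Controls

end HandsOff

/-! ### Attainment and strict convexity. -/

theorem theorem2 {n : ℕ} (hn : 0 < n) (A : Matrix (Fin n) (Fin n) ℝ) (B : Fin n → ℝ) (T : ℝ)
    (hT : 0 < T) (hAB : HandsOff.Controllable A B) (hA : A.det ≠ 0) :
    (∀ ξ ∈ HandsOff.reachable A B T,
      IsLeast (HandsOff.l0norm T '' HandsOff.admissible A B T ξ) (HandsOff.value A B T ξ)) ∧
    StrictConvexOn ℝ (HandsOff.reachable A B T) (HandsOff.value A B T) := by
  open HandsOff in
  have hopt := fun ξ (hξ : ξ ∈ reachable A B T) =>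
    exists_bangOffBang_minimizer hT.le hAB hA hξ
  refine ⟨fun ξ hξ => ?_, convex_reachable hT.le, fun ξ hξ η hη hne a b ha hb hab => ?_⟩
  · obtain ⟨u, hu, -, hl0, hmin⟩ := hopt ξ hξ
    have h := isLeast_l0norm hu hl0 fun v hv => (hmin v hv).1
    rwa [value, h.csInf_eq]
  obtain ⟨u, hu, hu3, hul0, humin⟩ := hopt ξ hξ
  obtain ⟨v, hv, hv3, hvl0, hvmin⟩ := hopt η hη
  obtain ⟨w, hw, hw3, hwl0, hwmin⟩ := hopt _ (convex_reachable hT.le hξ hη ha.le hb.le hab)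
  have hval {ζ u} (h1 : u ∈ admissible A B T ζ) (h2) (h3) :
      value A B T ζ = ∫ s in Set.Icc 0 T, |u s| :=
    (isLeast_l0norm h1 h2 h3).csInf_eq
  rw [hval hu hul0 fun z hz => (humin z hz).1, hval hv hvl0 fun z hz => (hvmin z hz).1,
    hval hw hwl0 fun z hz => (hwmin z hz).1, smul_eq_mul, smul_eq_mul]
  have hz : (fun s => a * u s + b * v s) ∈ admissible A B T (a • ξ + b • η) := by
    refine ⟨combo_mem_boundedControls hu.1 hv.1 ha.le hb.le hab, ?_⟩
    rw [steer_combo hT.le hu.1 hv.1, hu.2, hv.2, smul_neg, smul_neg, neg_add]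
  have hua := (mem_aeControls_of_mem_boundedControls hu.1)
  have hva := (mem_aeControls_of_mem_boundedControls hv.1)
  have hle := integral_abs_combo_le hua hva ha.le hb.le
  obtain ⟨hwz, huniq⟩ := hwmin _ hz
  -- Equality makes the mixture optimal, so it is a.e. the ternary `w`, and turns the integrated
  -- triangle inequality into a pointwise a.e. equality.
  refine lt_of_le_of_ne (hwz.trans hle) fun heq => hne ?_
  have hzw := huniq (le_antisymm (hle.trans heq.ge) hwz)
  have iu := integrable_of_mem_aeControls hua
  have iv := integrable_of_mem_aeControls hva
  have habs : (fun s => |a * u s + b * v s|) =ᵐ[volume.restrict (Set.Icc 0 T)]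
      fun s => a * |u s| + b * |v s| := by
    refine (integral_eq_iff_of_ae_le (f := fun s => |a * u s + b * v s|)
      (g := fun s => a * |u s| + b * |v s|) ((iu.const_mul a).add (iv.const_mul b)).abs
      ((iu.abs.const_mul a).add (iv.abs.const_mul b)) (ae_of_all _ fun s => ?_)).mp ?_
    · simpa [abs_mul, abs_of_pos ha, abs_of_pos hb] using abs_add_le (a * u s) (b * v s)
    · rw [integral_add (iu.abs.const_mul a) (iv.abs.const_mul b), integral_const_mul,
        integral_const_mul]
      exact le_antisymm hle (heq ▸ hwz)
  have huv : u =ᵐ[volume.restrict (Set.Icc 0 T)] v := by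
    filter_upwards [hzw, habs] with s h1 h2
    exact eq_of_combo_bangOffBang ha hb hab (hu3 s) (hv3 s) (by simpa only [h1] using hw3 s) h2
  rw [← neg_inj, ← hu.2, ← hv.2, steer_eq_setIntegral hT.le, steer_eq_setIntegral hT.le]
  refine integral_congr_ae ?_
  filter_upwards [huv] with s hs
  rw [hs]
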